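/- A $C^\infty$-ring is a set $A$ on which every smooth function $\mathbb R^n\to\mathbb R$ ($n\ge 0$) acts as an $n$-ary operation, compatibly with projections and composition (equivalently, a product preserving functor to sets from the category of the spaces $\mathbb R^n$ and smooth maps). It has an underlying commutative unital $\mathbb R$-algebra, an ideal of $A$ means an ideal of this algebra, and quotients of $A$ by ideals are again $C^\infty$-rings. For $a\in A$ let $A\{a^{-1}\}$ be the $C^\infty$-ring obtained from $A$ by universally inverting $a$ in the category of $C^\infty$-rings. For an ideal $I\le A$ define: - the nilradical $\operatorname{nil}(I)=\{a\in A : a^k\in I \text{ for some } k\ge 1\}$; - the $\infty$-radical $\operatorname{rad}_\infty(I)=\{a\in A : (A/I)\{a^{-1}\}\cong 0\}$, where $a$ also denotes its class in $A/I$; - the $\mathbb R$-Jacobson radical $\operatorname{rad}_{\mathbb R}(I)$, the intersection of all maximal ideals of $A$ that contain $I$ and have residue field $\mathbb R$ (all of $A$ if there are none). All three are ideals of $A$. **Lemma.** Let $A$ be a $C^\infty$-ring and let $I\le A$ be any ideal. Then $$\operatorname{nil}(\operatorname{nil} I)=\operatorname{nil} I,\qquad \operatorname{rad}_\infty(\operatorname{rad}_\infty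 I)=\operatorname{rad}_\infty I,\qquad \operatorname{rad}_{\mathbb R}(\operatorname{rad}_{\mathbb R} I)=\operatorname{rad}_{\mathbb R} I,$$ $$\operatorname{rad}_\infty(\operatorname{nil} I)=\operatorname{rad}_\infty I,\qquad \operatorname{rad}_{\mathbb R}(\operatorname{rad}_\infty I)=\operatorname{rad}_{\mathbb R} I,\qquad \operatorname{rad}_{\mathbb R}(\operatorname{nil} I)=\operatorname{rad}_{\mathbb R} I,$$ $$\operatorname{nil}(\operatorname{rad}_\infty I)=\operatorname{rad}_\infty I,\qquad \operatorname{nil}(\operatorname{rad}_{\mathbb R} I)=\operatorname{rad}_{\mathbb R} I,\qquad \operatorname{rad}_\infty(\operatorname{rad}_{\mathbb R} I)=\operatorname{rad}_{\mathbb R} I.$$ -/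

import Mathlib

open scoped ContDiff

namespace SmoothFun

/-- Integrals of `C^n` functions over `[0, 1]` depend in a `C^n` way on parameters. -/
theorem contDiff_integral_param_nat (n : ℕ) : ∀ {E F : Type} [NormedAddCommGroup E] [NormedSpace ℝ E]
    [NormedAddCommGroup F] [NormedSpace ℝ F] [CompleteSpace F] (G : E × ℝ → F),
    ContDiff ℝ n G → ContDiff ℝ n (fun x => ∫ t in (0:ℝ)..1, G (x, t)) := by
  induction n with
  | zero =>
    intro E F _ _ _ _ _ G hG
    have hc : Continuous G := hG.continuous
    exact contDiff_zero.2
      (intervalIntegral.continuous_parametric_intervalIntegral_of_continuous' (by fun_prop) 0 1)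
  | succ n ih =>
    intro E F _ _ _ _ _ G hG
    have hd : Differentiable ℝ G := hG.differentiable (by simp)
    let G' : E × ℝ → E →L[ℝ] F := fun p => (fderiv ℝ G p).comp (ContinuousLinearMap.inl ℝ E ℝ)
    have hG' : ContDiff ℝ n G' := by
      have h1 : ContDiff ℝ n (fderiv ℝ G) := hG.fderiv_right (by simp)
      exact h1.clm_comp contDiff_const
    have hc : Continuous G := hG.continuous
    have hc' : Continuous G' := hG'.continuous
    have hder : ∀ x, HasFDerivAt (fun x => ∫ t in (0:ℝ)..1, G (x, t))
        (∫ t in (0:ℝ)..1, G' (x, t)) x := by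
      intro x
      obtain ⟨C, hC⟩ : ∃ C, ∀ p ∈ ({x} : Set E) ×ˢ Set.Icc (0:ℝ) 1, ‖G' p‖ ≤ C :=
        (isCompact_singleton.prod isCompact_Icc).exists_bound_of_continuousOn hc'.continuousOn
      have hopen : IsOpen {p : E × ℝ | ‖G' p‖ < C + 1} :=
        isOpen_lt (by fun_prop) continuous_const
      obtain ⟨U, V, hU, -, hxU, hV, hUV⟩ := generalized_tube_lemma
        (s := ({x} : Set E)) isCompact_singleton (t := Set.Icc (0:ℝ) 1) isCompact_Icc hopen
        (fun p hp => lt_of_le_of_lt (hC p hp) (by simp))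
      refine intervalIntegral.hasFDerivAt_integral_of_dominated_of_fderiv_le
        (F' := fun x t => G' (x, t)) (bound := fun _ => C + 1)
        (hU.mem_nhds (hxU rfl)) ?_ ?_ ?_ ?_ ?_ ?_
      · exact Filter.Eventually.of_forall fun y =>
          (show Continuous fun t => G (y, t) by fun_prop).aestronglyMeasurable
      · exact (show Continuous fun t => G (x, t) by fun_prop).intervalIntegrable _ _
      · exact (show Continuous fun t => G' (x, t) by fun_prop).aestronglyMeasurable
      · refine Filter.Eventually.of_forall fun t ht y hy => ?_
        have ht' : t ∈ Set.Icc (0:ℝ) 1 := by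
          rw [Set.uIoc_of_le zero_le_one] at ht
          exact ⟨ht.1.le, ht.2⟩
        exact le_of_lt (hUV (Set.mk_mem_prod hy (hV ht')))
      · exact intervalIntegrable_const
      · refine Filter.Eventually.of_forall fun t _ y _ => ?_
        have h1 : HasFDerivAt (fun y : E => (y, t)) (ContinuousLinearMap.inl ℝ E ℝ) y :=
          hasFDerivAt_prodMk_left y t
        exact (hd (y, t)).hasFDerivAt.comp y h1
    have : ContDiff ℝ ((n : WithTop ℕ∞) + 1) (fun x => ∫ t in (0:ℝ)..1, G (x, t)) := by
      rw [contDiff_succ_iff_hasFDerivAt]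
      exact ⟨_, ih G' hG', hder⟩
    exact_mod_cast this

/-- Hadamard's lemma. -/
theorem hadamard {n : ℕ} (f : (Fin n → ℝ) → ℝ) (hf : ContDiff ℝ ∞ f) :
    ∃ g : Fin n → (Fin n → ℝ) × (Fin n → ℝ) → ℝ, (∀ i, ContDiff ℝ ∞ (g i)) ∧
      ∀ x y, f x - f y = ∑ i, (x i - y i) * g i (x, y) := by
  have hf1 : ContDiff ℝ ∞ (fderiv ℝ f) := hf.fderiv_right (by simp)
  have hd : Differentiable ℝ f := hf.differentiable (by simp)
  refine ⟨fun i p => ∫ t in (0:ℝ)..1,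
    fderiv ℝ f (p.2 + t • (p.1 - p.2)) (Pi.single i 1), fun i => ?_, fun x y => ?_⟩
  · refine contDiff_infty.2 fun k => contDiff_integral_param_nat k
      (fun q : ((Fin n → ℝ) × (Fin n → ℝ)) × ℝ =>
        fderiv ℝ f (q.1.2 + q.2 • (q.1.1 - q.1.2)) (Pi.single i 1)) ?_
    refine ContDiff.of_le ?_ (WithTop.coe_le_coe.2 le_top : (k : WithTop ℕ∞) ≤ ∞)
    refine ContDiff.clm_apply (hf1.comp ?_) contDiff_const
    fun_prop
  · have hp : ∀ t : ℝ, HasDerivAt (fun t : ℝ => f (y + t • (x - y)))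
        (∑ i, (x i - y i) * fderiv ℝ f (y + t • (x - y)) (Pi.single i 1)) t := by
      intro t
      have h1 : HasDerivAt (fun t : ℝ => y + t • (x - y)) (x - y) t := by
        simpa using ((hasDerivAt_id t).smul_const (x - y)).const_add y
      have h2 := (hd (y + t • (x - y))).hasFDerivAt.comp_hasDerivAt t h1
      refine h2.congr_deriv ?_
      conv_lhs => rw [← Finset.univ_sum_single (x - y)]
      rw [map_sum]
      refine Finset.sum_congr rfl fun i _ => ?_
      have : (Pi.single i ((x - y) i) : Fin n → ℝ) = (x i - y i) • Pi.single i (1:ℝ) := by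
        rw [← Pi.single_smul]; simp
      rw [this, map_smul, smul_eq_mul, Finset.univ_sum_single]
    have hcont : ∀ i, Continuous fun t : ℝ => fderiv ℝ f (y + t • (x - y)) (Pi.single i 1) :=
      fun i => (hf1.continuous.comp (by fun_prop)).clm_apply continuous_const
    have := intervalIntegral.integral_eq_sub_of_hasDerivAt (fun t _ => hp t) (a := 0) (b := 1)
      (Continuous.intervalIntegrable (by fun_prop) _ _)
    simp only [one_smul, zero_smul, add_zero, add_sub_cancel] at this
    rw [← this, intervalIntegral.integral_finsetSum
      (fun i _ => Continuous.intervalIntegrable (by fun_prop) _ _)]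
    simp

end SmoothFun

universe u v w

/-- Smooth functions `ℝⁿ → ℝ`, i.e. the `n`-ary operations of the theory of `C^∞`-rings. -/
abbrev SmoothFun (n : ℕ) := {f : (Fin n → ℝ) → ℝ // ContDiff ℝ ∞ f}

namespace SmoothFun

/-- The `i`-th coordinate function. -/
def proj {n : ℕ} (i : Fin n) : SmoothFun n := ⟨fun u => u i, by fun_prop⟩

/-- The function `u ↦ f (g₀ u, …, gₘ₋₁ u)`. -/
def comp {m n : ℕ} (f : SmoothFun m) (g : Fin m → SmoothFun n) : SmoothFun n :=
  ⟨fun u => f.1 fun i => (g i).1 u, f.2.comp (contDiff_pi.2 fun i => (g i).2)⟩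

/-- A constant function. -/
def const (n : ℕ) (c : ℝ) : SmoothFun n := ⟨fun _ => c, contDiff_const⟩

/-- Addition `ℝ² → ℝ`. -/
def add : SmoothFun 2 := ⟨fun u => u 0 + u 1, by fun_prop⟩

/-- Multiplication `ℝ² → ℝ`. -/
def mul : SmoothFun 2 := ⟨fun u => u 0 * u 1, by fun_prop⟩

end SmoothFun

/-- A `C^∞`-ring: a set `A` on which every smooth function `ℝⁿ → ℝ` acts as an `n`-ary operation,
compatibly with projections and composition (equivalently, a product preserving functor to sets
from the category of the `ℝⁿ` and smooth maps). The last three laws say that the commutative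
`ℝ`-algebra structure of `A` is the one given by the operations. -/
class CInftyRing (A : Type u) [CommRing A] [Algebra ℝ A] where
  op : ∀ {n : ℕ}, SmoothFun n → (Fin n → A) → A
  op_proj : ∀ {n : ℕ} (i : Fin n) (x : Fin n → A), op (SmoothFun.proj i) x = x i
  op_comp : ∀ {m n : ℕ} (f : SmoothFun m) (g : Fin m → SmoothFun n) (x : Fin n → A),
    op (f.comp g) x = op f fun i => op (g i) x
  op_add : ∀ x : Fin 2 → A, op SmoothFun.add x = x 0 + x 1
  op_mul : ∀ x : Fin 2 → A, op SmoothFun.mul x = x 0 * x 1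
  op_const : ∀ (n : ℕ) (c : ℝ) (x : Fin n → A), op (SmoothFun.const n c) x = algebraMap ℝ A c

namespace CInftyRing

section Hom

variable {A : Type u} [CommRing A] [Algebra ℝ A] [CInftyRing A]
  {B : Type v} [CommRing B] [Algebra ℝ B] [CInftyRing B]

/-- Morphisms of `C^∞`-rings: maps that preserve all the operations. -/
structure IsHom (φ : A →ₐ[ℝ] B) : Prop where
  map_op : ∀ {n : ℕ} (f : SmoothFun n) (x : Fin n → A), φ (op f x) = op f fun i => φ (x i)

theorem IsHom.comp {C : Type w} [CommRing C] [Algebra ℝ C] [CInftyRing C]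
    {ψ : B →ₐ[ℝ] C} {φ : A →ₐ[ℝ] B} (hψ : IsHom ψ) (hφ : IsHom φ) : IsHom (ψ.comp φ) := by
  refine ⟨fun f x => ?_⟩
  simp [hφ.map_op f, hψ.map_op f]

/-- Reindexing the arguments of an operation. -/
theorem op_reindex {m n : ℕ} (f : SmoothFun m) (α : Fin m → Fin n) (x : Fin n → A) :
    op (f.comp fun i => SmoothFun.proj (α i)) x = op f fun i => x (α i) := by
  rw [op_comp]
  simp only [op_proj]

/-- A map that preserves all the operations is a morphism of `ℝ`-algebras. -/
def algHomOfOp (F : A → B)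
    (hF : ∀ {n : ℕ} (f : SmoothFun n) (x : Fin n → A), F (op f x) = op f fun i => F (x i)) :
    A →ₐ[ℝ] B where
  toFun := F
  map_add' a b := by
    have := hF SmoothFun.add ![a, b]
    simpa [op_add] using this
  map_mul' a b := by
    have := hF SmoothFun.mul ![a, b]
    simpa [op_mul] using this
  commutes' c := by
    have := hF (SmoothFun.const 0 c) ![]
    simpa [op_const] using this
  map_one' := by
    have := hF (SmoothFun.const 0 1) ![]
    simpa [op_const] using this
  map_zero' := by
    have := hF (SmoothFun.const 0 0) ![]
    simpa [op_const] using this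

theorem isHom_algHomOfOp (F : A → B)
    (hF : ∀ {n : ℕ} (f : SmoothFun n) (x : Fin n → A), F (op f x) = op f fun i => F (x i)) :
    IsHom (algHomOfOp F hF) := ⟨hF⟩

end Hom

section Quotient

variable {A : Type u} [CommRing A] [Algebra ℝ A] [CInftyRing A]

theorem op_sum {n m : ℕ} (g : Fin m → SmoothFun n) (x : Fin n → A) :
    op (⟨fun u => ∑ i, (g i).1 u, ContDiff.sum fun i _ => (g i).2⟩ : SmoothFun n) x =
      ∑ i, op (g i) x := by
  induction m with
  | zero =>
    have := op_const n 0 x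
    simpa [SmoothFun.const] using this
  | succ m ih =>
    rw [Fin.sum_univ_succ, ← ih]
    have := op_comp SmoothFun.add
      ![g 0, ⟨fun u => ∑ i : Fin m, (g i.succ).1 u, ContDiff.sum fun i _ => (g i.succ).2⟩] x
    rw [op_add] at this
    simp only [Matrix.cons_val_zero, Matrix.cons_val_one] at this
    rw [← this]
    congr 1
    ext u
    simp [SmoothFun.comp, SmoothFun.add, Fin.sum_univ_succ]

/-- Ideals are congruences for all the operations. -/
theorem op_sub_mem (I : Ideal A) {n : ℕ} (f : SmoothFun n) (x y : Fin n → A)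
    (h : ∀ i, x i - y i ∈ I) : op f x - op f y ∈ I := by
  obtain ⟨g, hg, hfg⟩ := SmoothFun.hadamard f.1 f.2
  let L : (Fin (n + n) → ℝ) → (Fin n → ℝ) × (Fin n → ℝ) :=
    fun u => (fun i => u (Fin.castAdd n i), fun i => u (Fin.natAdd n i))
  have hL : ContDiff ℝ ∞ L := by fun_prop
  let G : Fin n → SmoothFun (n + n) := fun i => ⟨fun u => g i (L u), (hg i).comp hL⟩
  let P : Fin n → SmoothFun (n + n) := fun i => SmoothFun.proj (Fin.castAdd n i)
  let Q : Fin n → SmoothFun (n + n) := fun i => SmoothFun.proj (Fin.natAdd n i)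
  let Qneg : Fin n → SmoothFun (n + n) := fun i =>
    SmoothFun.mul.comp ![SmoothFun.const _ (-1), Q i]
  let H : Fin n → SmoothFun (n + n) := fun i =>
    SmoothFun.mul.comp ![SmoothFun.add.comp ![P i, Qneg i], G i]
  let z : Fin (n + n) → A := Fin.append x y
  have hP : ∀ i, op (P i) z = x i := fun i => by simp [P, op_proj, z]
  have hQ : ∀ i, op (Q i) z = y i := fun i => by
    simp only [Q, op_proj, z, Fin.append_right]
  have hH : ∀ i, op (H i) z = (x i - y i) * op (G i) z := fun i => by
    simp [H, Qneg, op_comp, op_mul, op_add, hP, hQ, op_const, sub_eq_add_neg]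
  have key : f.comp P = SmoothFun.add.comp ![f.comp Q,
      ⟨fun u => ∑ i, (H i).1 u, ContDiff.sum fun i _ => (H i).2⟩] := by
    ext u
    have := hfg (L u).1 (L u).2
    simp only [SmoothFun.comp, SmoothFun.add, SmoothFun.proj, SmoothFun.mul, SmoothFun.const,
      P, Q, H, G, Qneg, L, Matrix.cons_val_zero, Matrix.cons_val_one] at this ⊢
    rw [sub_eq_iff_eq_add] at this
    rw [this, add_comm]
    congr 1
    refine Finset.sum_congr rfl fun i _ => ?_
    ring
  have h1 : op (f.comp P) z = op f x := by rw [op_comp]; simp only [hP]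
  have h2 : op (f.comp Q) z = op f y := by rw [op_comp]; simp only [hQ]
  rw [← h1, key, op_comp, op_add]
  simp only [Matrix.cons_val_zero, Matrix.cons_val_one]
  rw [h2, add_sub_cancel_left, op_sum]
  refine Ideal.sum_mem _ fun i _ => ?_
  rw [hH]
  exact Ideal.mul_mem_right _ _ (h i)

theorem op_mk_eq (I : Ideal A) {n : ℕ} (f : SmoothFun n) (x y : Fin n → A)
    (h : ∀ i, Ideal.Quotient.mk I (x i) = Ideal.Quotient.mk I (y i)) :
    Ideal.Quotient.mk I (op f x) = Ideal.Quotient.mk I (op f y) :=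
  Ideal.Quotient.eq.2 (op_sub_mem I f x y fun i => Ideal.Quotient.eq.1 (h i))

/-- The quotient `C^∞`-ring `A ⧸ I`: the operations are applied to representatives. -/
noncomputable instance quotient (I : Ideal A) : CInftyRing (A ⧸ I) where
  op f x := Ideal.Quotient.mk I (op f fun i => Quotient.out (x i))
  op_proj i x := by
    rw [op_proj]
    exact Ideal.Quotient.mk_out _
  op_comp f g x := by
    rw [op_comp]
    exact op_mk_eq I f _ _ fun i => (Ideal.Quotient.mk_out _).symm
  op_add x := by
    rw [op_add, map_add]
    exact congrArg₂ _ (Ideal.Quotient.mk_out _) (Ideal.Quotient.mk_out _)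
  op_mul x := by
    rw [op_mul, map_mul]
    exact congrArg₂ _ (Ideal.Quotient.mk_out _) (Ideal.Quotient.mk_out _)
  op_const n c x := by
    rw [op_const]
    rfl

theorem isHom_mk (I : Ideal A) : IsHom (Ideal.Quotient.mkₐ ℝ I) := by
  refine ⟨fun f x => ?_⟩
  exact op_mk_eq I f _ _ fun i => (Ideal.Quotient.mk_out _).symm

theorem isHom_lift (I : Ideal A) {B : Type v} [CommRing B] [Algebra ℝ B] [CInftyRing B]
    (φ : A →ₐ[ℝ] B) (hφ : IsHom φ) (h : ∀ a ∈ I, φ a = 0) :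
    IsHom (Ideal.Quotient.liftₐ I φ h) := by
  refine ⟨fun f x => ?_⟩
  have : x = fun i => Ideal.Quotient.mkₐ ℝ I (Quotient.out (x i)) :=
    funext fun i => (Ideal.Quotient.mk_out _).symm
  rw [this, ← (isHom_mk I).map_op f]
  exact hφ.map_op f _

end Quotient

section Free

/-- The free `C^∞`-ring `C^∞(ℝ^S)` on a set `S`: the functions `ℝ^S → ℝ` that factor as a
projection `ℝ^S → ℝⁿ` to finitely many coordinates followed by a smooth function. -/
def freeCarrier (S : Type u) : Set ((S → ℝ) → ℝ) :=
  {F | ∃ (n : ℕ) (s : Fin n → S) (g : SmoothFun n), F = fun x => g.1 fun i => x (s i)}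

theorem freeCarrier_op {S : Type u} {m : ℕ} (f : SmoothFun m) (F : Fin m → (S → ℝ) → ℝ)
    (hF : ∀ i, F i ∈ freeCarrier S) : (fun x => f.1 fun i => F i x) ∈ freeCarrier S := by
  choose n s g h using hF
  refine ⟨∑ i, n i, fun k => s (finSigmaFinEquiv.symm k).1 (finSigmaFinEquiv.symm k).2,
    f.comp fun i => (g i).comp fun j => SmoothFun.proj (finSigmaFinEquiv ⟨i, j⟩), ?_⟩
  funext x
  simp only [SmoothFun.comp, SmoothFun.proj, h]
  refine congrArg f.1 (funext fun i => congrArg (g i).1 (funext fun j => ?_))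
  rw [Equiv.symm_apply_apply]

/-- `C^∞(ℝ^S)` as an `ℝ`-algebra of functions on `ℝ^S`. -/
def Free (S : Type u) : Subalgebra ℝ ((S → ℝ) → ℝ) where
  carrier := freeCarrier S
  mul_mem' {a b} ha hb := by
    have := freeCarrier_op SmoothFun.mul ![a, b] (by simp [Fin.forall_fin_two, ha, hb])
    have h : a * b = fun x => SmoothFun.mul.1 fun i => ![a, b] i x := rfl
    rw [h]
    exact this
  add_mem' {a b} ha hb := by
    have := freeCarrier_op SmoothFun.add ![a, b] (by simp [Fin.forall_fin_two, ha, hb])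
    have h : a + b = fun x => SmoothFun.add.1 fun i => ![a, b] i x := rfl
    rw [h]
    exact this
  algebraMap_mem' c := ⟨0, Fin.elim0, SmoothFun.const 0 c, rfl⟩

/-- The operations on `C^∞(ℝ^S)` are given by composition of functions. -/
instance free (S : Type u) : CInftyRing (Free S) where
  op f F := ⟨fun x => f.1 fun i => (F i).1 x, freeCarrier_op f _ fun i => (F i).2⟩
  op_proj _ _ := rfl
  op_comp _ _ _ := rfl
  op_add _ := rfl
  op_mul _ := rfl
  op_const _ _ _ := rfl

/-- The generators of `C^∞(ℝ^S)`: the coordinate functions. -/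
def X {S : Type u} (s : S) : Free S :=
  ⟨fun x => x s, 1, fun _ => s, SmoothFun.proj 0, rfl⟩

theorem free_eq_op {S : Type u} (F : Free S) :
    ∃ (n : ℕ) (s : Fin n → S) (g : SmoothFun n), F = op g fun i => X (s i) := by
  obtain ⟨F, n, s, g, rfl⟩ := F
  exact ⟨n, s, g, rfl⟩

variable {B : Type v} [CommRing B] [Algebra ℝ B] [CInftyRing B]

theorem op_eq_of_free_eq {S : Type u} {n m : ℕ} (s : Fin n → S) (t : Fin m → S)
    (g : SmoothFun n) (h : SmoothFun m)
    (H : ∀ x : S → ℝ, (g.1 fun i => x (s i)) = h.1 fun i => x (t i)) (φ : S → B) :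
    (op g fun i => φ (s i)) = op h fun i => φ (t i) := by
  classical
  let T : Finset S := Finset.univ.image s ∪ Finset.univ.image t
  let e : T ≃ Fin T.card := T.equivFin
  let α : Fin n → Fin T.card := fun i => e ⟨s i, by simp [T]⟩
  let β : Fin m → Fin T.card := fun i => e ⟨t i, by simp [T]⟩
  have hα : ∀ i, ((e.symm (α i) : T) : S) = s i := fun i => by simp [α]
  have hβ : ∀ i, ((e.symm (β i) : T) : S) = t i := fun i => by simp [β]
  have h1 := op_reindex g α fun k => φ (e.symm k : T)
  have h2 := op_reindex h β fun k => φ (e.symm k : T)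
  simp only [hα] at h1
  simp only [hβ] at h2
  rw [← h1, ← h2]
  congr 1
  ext w
  simp only [SmoothFun.comp, SmoothFun.proj]
  have := H fun a => if ha : a ∈ T then w (e ⟨a, ha⟩) else 0
  have hs : ∀ i, s i ∈ T := fun i => by simp [T]
  have ht : ∀ i, t i ∈ T := fun i => by simp [T]
  simpa only [hs, ht, dif_pos, α, β] using this

theorem exists_free_lift {S : Type u} (φ : S → B) :
    ∃ ψ : Free S →ₐ[ℝ] B, IsHom ψ ∧ ∀ s, ψ (X s) = φ s := by
  choose n s g h using fun F : Free S => free_eq_op F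
  let ev : Free S → B := fun F => op (g F) fun i => φ (s F i)
  have hev : ∀ {m : ℕ} (t : Fin m → S) (k : SmoothFun m),
      ev (op k fun i => X (t i)) = op k fun i => φ (t i) := by
    intro m t k
    refine op_eq_of_free_eq _ _ _ _ (fun x => ?_) φ
    have := h (op k fun i => X (t i))
    exact (congrFun (congrArg Subtype.val this) x).symm
  have hop : ∀ {m : ℕ} (f : SmoothFun m) (F : Fin m → Free S),
      ev (op f F) = op f fun i => ev (F i) := by
    intro m f F
    let N : ℕ := ∑ i, n (F i)
    let σ : (Σ i : Fin m, Fin (n (F i))) ≃ Fin N := finSigmaFinEquiv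
    let t : Fin N → S := fun k => s (F (σ.symm k).1) (σ.symm k).2
    let G : Fin m → SmoothFun N := fun i => (g (F i)).comp fun j => SmoothFun.proj (σ ⟨i, j⟩)
    have ht : ∀ i j, t (σ ⟨i, j⟩) = s (F i) j := fun i j => by
      simp only [t]
      rw [Equiv.symm_apply_apply]
    have hF : ∀ i, F i = op (G i) fun k => X (t k) := fun i => by
      rw [op_reindex]
      simp only [ht]
      exact h (F i)
    have hevF : ∀ i, ev (F i) = op (G i) fun k => φ (t k) := fun i => by
      rw [op_reindex]
      simp only [ht, ev]
    have : op f F = op (f.comp G) fun k => X (t k) := by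
      rw [op_comp]
      exact congrArg _ (funext hF)
    rw [this, hev, op_comp]
    exact congrArg _ (funext fun i => (hevF i).symm)
  refine ⟨algHomOfOp ev hop, isHom_algHomOfOp ev hop, fun a => ?_⟩
  have := hev (fun _ : Fin 1 => a) (SmoothFun.proj 0)
  simp only [op_proj] at this
  exact this

end Free

section Localization

variable {A : Type u} [CommRing A] [Algebra ℝ A] [CInftyRing A]

/-- The relations that present `A{a⁻¹}` on the generators `x_b` (`b ∈ A`) and `y`: all relations
`x_{f(b₁, …, bₙ)} = f(x_{b₁}, …, x_{bₙ})` that hold in `A`, and `x_a y = 1`. -/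
inductive InvertRel (a : A) : Free (Option A) → Prop
  | op {n : ℕ} (f : SmoothFun n) (b : Fin n → A) :
      InvertRel a (X (some (op f b)) - op f fun i => X (some (b i)))
  | inv : InvertRel a (X (some a) * X none - 1)

/-- The `C^∞`-ring `A{a⁻¹}` obtained from `A` by inverting `a` in the category of
`C^∞`-rings. -/
def Invert (a : A) : Type u := Free (Option A) ⧸ Ideal.span {r | InvertRel a r}

noncomputable instance (a : A) : CommRing (Invert a) :=
  inferInstanceAs (CommRing (Free (Option A) ⧸ Ideal.span {r | InvertRel a r}))

noncomputable instance (a : A) : Algebra ℝ (Invert a) :=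
  inferInstanceAs (Algebra ℝ (Free (Option A) ⧸ Ideal.span {r | InvertRel a r}))

noncomputable instance (a : A) : CInftyRing (Invert a) :=
  quotient (Ideal.span {r | InvertRel a r})

/-- The quotient map onto `A{a⁻¹}`. -/
noncomputable def Invert.mk (a : A) : Free (Option A) →ₐ[ℝ] Invert a :=
  Ideal.Quotient.mkₐ ℝ (Ideal.span {r | InvertRel a r})

theorem Invert.isHom_mk (a : A) : IsHom (Invert.mk a) :=
  ⟨(CInftyRing.isHom_mk (Ideal.span {r | InvertRel a r})).map_op⟩

theorem Invert.mk_op (a : A) {n : ℕ} (f : SmoothFun n) (b : Fin n → A) :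
    Invert.mk a (X (some (op f b))) = op f fun i => Invert.mk a (X (some (b i))) := by
  rw [← (Invert.isHom_mk a).map_op f]
  exact Ideal.Quotient.eq.2 (Ideal.subset_span (InvertRel.op f b))

theorem Invert.mk_mul (a : A) :
    Invert.mk a (X (some a)) * Invert.mk a (X none) = 1 := by
  rw [← map_mul, ← map_one (Invert.mk a)]
  exact Ideal.Quotient.eq.2 (Ideal.subset_span InvertRel.inv)

/-- The canonical morphism `A → A{a⁻¹}`. -/
noncomputable def toInvert (a : A) : A →ₐ[ℝ] Invert a :=
  algHomOfOp (fun b => Invert.mk a (X (some b))) (Invert.mk_op a)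

theorem isHom_toInvert (a : A) : IsHom (toInvert a) := isHom_algHomOfOp _ (Invert.mk_op a)

theorem isUnit_toInvert (a : A) : IsUnit (toInvert a a) :=
  IsUnit.of_mul_eq_one (Invert.mk a (X none)) (Invert.mk_mul a)

variable {B : Type v} [CommRing B] [Algebra ℝ B] [CInftyRing B]

/-- The universal property of `A{a⁻¹}`: morphisms `A → B` that make `a` invertible extend
uniquely to `A{a⁻¹}`. -/
theorem existsUnique_invert_lift (a : A) (φ : A →ₐ[ℝ] B) (hφ : IsHom φ) (ha : IsUnit (φ a)) :
    ∃! ψ : Invert a →ₐ[ℝ] B, IsHom ψ ∧ ψ.comp (toInvert a) = φ := by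
  obtain ⟨c, hc⟩ := ha.exists_right_inv
  obtain ⟨ψ₀, hψ₀, hX⟩ := exists_free_lift (B := B) fun o : Option A => o.elim c φ
  have hker : ∀ r ∈ Ideal.span {r | InvertRel a r}, ψ₀ r = 0 := by
    have : Ideal.span {r | InvertRel a r} ≤ RingHom.ker ψ₀ := by
      rw [Ideal.span_le]
      rintro r (⟨f, b⟩ | _)
      · simp [RingHom.mem_ker, hψ₀.map_op f, hX, hφ.map_op f]
      · simp [RingHom.mem_ker, hX, hc]
    exact this
  have hlift := isHom_lift _ ψ₀ hψ₀ hker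
  refine ⟨(Ideal.Quotient.liftₐ _ ψ₀ hker : _ →ₐ[ℝ] B), ⟨⟨hlift.map_op⟩, ?_⟩, ?_⟩
  · ext b
    exact hX (some b)
  · rintro χ ⟨hχ, hχφ⟩
    have hsome : ∀ b, χ (Invert.mk a (X (some b))) = φ b := fun b => DFunLike.congr_fun hχφ b
    have hnone : χ (Invert.mk a (X none)) = c := by
      have h := congrArg χ (Invert.mk_mul a)
      rw [map_mul, hsome, map_one] at h
      exact ha.mul_left_cancel (h.trans hc.symm)
    refine AlgHom.ext fun z => ?_
    obtain ⟨F, rfl⟩ : ∃ F, Invert.mk a F = z := Ideal.Quotient.mk_surjective z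
    change χ (Invert.mk a F) = ψ₀ F
    obtain ⟨n, s, g, rfl⟩ := free_eq_op F
    rw [(Invert.isHom_mk a).map_op g, hχ.map_op g, hψ₀.map_op g]
    refine congrArg _ (funext fun i => ?_)
    rw [hX]
    cases s i with
    | none => exact hnone
    | some b => exact hsome b

end Localization

section Radicals

variable {A : Type u} [CommRing A] [Algebra ℝ A] [CInftyRing A]

/-- `(A ⧸ I){a⁻¹}` is trivial if and only if every morphism that kills `I` and inverts `a` has
trivial target. -/
theorem subsingleton_invert_iff (I : Ideal A) (a : A) :
    Subsingleton (Invert (Ideal.Quotient.mk I a)) ↔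
      ∀ (B : Type u) [CommRing B] [Algebra ℝ B] [CInftyRing B] (φ : A →ₐ[ℝ] B),
        IsHom φ → (∀ b ∈ I, φ b = 0) → IsUnit (φ a) → Subsingleton B := by
  constructor
  · intro h B _ _ _ φ hφ hI ha
    obtain ⟨ψ, -, -⟩ := existsUnique_invert_lift (Ideal.Quotient.mk I a)
      (Ideal.Quotient.liftₐ I φ hI) (isHom_lift I φ hφ hI) ha
    exact ψ.toRingHom.codomain_trivial
  · intro h
    refine h _ ((toInvert (Ideal.Quotient.mk I a)).comp (Ideal.Quotient.mkₐ ℝ I))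
      ((isHom_toInvert _).comp (isHom_mk I)) (fun b hb => ?_) (isUnit_toInvert _)
    have : Ideal.Quotient.mkₐ ℝ I b = 0 := Ideal.Quotient.eq_zero_iff_mem.2 hb
    rw [AlgHom.comp_apply, this, map_zero]

/-- The `∞`-radical of an ideal `I` of a `C^∞`-ring `A`: the set of all `a ∈ A` such that
`(A ⧸ I){a⁻¹}` is the zero ring. -/
def inftyRadical (I : Ideal A) : Ideal A where
  carrier := {a | Subsingleton (Invert (Ideal.Quotient.mk I a))}
  zero_mem' := by
    rw [Set.mem_ofPred_eq, subsingleton_invert_iff]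
    intro B _ _ _ φ _ _ h0
    rw [map_zero, isUnit_zero_iff] at h0
    exact subsingleton_of_zero_eq_one h0
  smul_mem' c a ha := by
    rw [Set.mem_ofPred_eq, subsingleton_invert_iff] at ha ⊢
    intro B _ _ _ φ hφ hI hca
    rw [smul_eq_mul, map_mul] at hca
    exact ha B φ hφ hI (isUnit_of_mul_isUnit_right hca)
  add_mem' {a b} ha hb := by
    rw [Set.mem_ofPred_eq, subsingleton_invert_iff] at ha hb ⊢
    intro B _ _ _ φ hφ hI hab
    refine hb B φ hφ hI ?_
    have h1 : Subsingleton (B ⧸ Ideal.span {φ b}) := by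
      refine ha _ ((Ideal.Quotient.mkₐ ℝ _).comp φ) ((isHom_mk _).comp hφ)
        (fun c hc => by rw [AlgHom.comp_apply, hI c hc, map_zero]) ?_
      have h2 : Ideal.Quotient.mk (Ideal.span {φ b}) (φ b) = 0 :=
        Ideal.Quotient.eq_zero_iff_mem.2 (Ideal.mem_span_singleton_self _)
      have h3 := hab.map (Ideal.Quotient.mk (Ideal.span {φ b}))
      rw [map_add, map_add, h2, add_zero] at h3
      exact h3
    exact Ideal.span_singleton_eq_top.1 (Ideal.Quotient.subsingleton_iff.1 h1)

/-- The `ℝ`-Jacobson radical of an ideal `I`: the intersection of all maximal ideals containing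
`I` whose residue field is `ℝ` (the whole ring, if there are none). -/
def realJacobson (I : Ideal A) : Ideal A :=
  sInf {M | I ≤ M ∧ M.IsMaximal ∧ Nonempty ((A ⧸ M) ≃ₐ[ℝ] ℝ)}

end Radicals

end CInftyRing

/-! Everything follows from the chain `I ≤ I.radical ≤ inftyRadical I ≤ realJacobson I`,
monotonicity, and idempotence of the three operators: a composite of two of them is squeezed between
the larger one and its square. The first inclusion past `I` holds because a nilpotent unit forces
the zero ring, the next because `A ⧸ M` is a field and again a `C^∞`-ring. Only the idempotence of
the `∞`-radical (`inftyRadical_idem`) needs analysis.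

Let `C = (A ⧸ I){a⁻¹}` with `a` in the iterated `∞`-radical. The extension of `inftyRadical I` to
`C` is the unit ideal. If elements of extended ideals are fractions with numerator in the ideal,
then `1 = t / s` with `t` from `inftyRadical I`, so `t` is a unit in `C`. As `A → C` kills `I`, the
definition of the `∞`-radical gives `C = 0`.

The fractions come from `exists_toInvert_mul_eq`. An element of `A{a⁻¹}` is `f(x, a⁻¹)` with `f`
smooth. The function `f(u, 1 / u i)` is smooth only where `u i ≠ 0`, but
`exists_contDiff_mul_extension` multiplies it by some `s` without zeros there, so that the product
`g` is globally smooth. To transfer `s * f = g` and the invertibility of `s` to `A{a⁻¹}`, identities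
valid on `u i * u j = 1` must hold at all points satisfying this equation (`op_eq_of_eqOn`). This
follows from `exists_eq_mul_of_eq_zero`, a consequence of Hadamard's lemma and a cutoff. -/

namespace SmoothFun

/-! ### Extending smooth functions from open sets after multiplication -/

/-- A sequence of compactly supported smooth functions can be rescaled so that its sum is
smooth. -/
theorem exists_pos_smul_contDiff_tsum {E F : Type*} [NormedAddCommGroup E] [NormedSpace ℝ E]
    [NormedAddCommGroup F] [NormedSpace ℝ F] [CompleteSpace F] (g : ℕ → E → F)
    (hg : ∀ n, ContDiff ℝ ∞ (g n)) (hc : ∀ n, HasCompactSupport (g n)) :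
    ∃ r : ℕ → ℝ, (∀ n, 0 < r n) ∧ (∀ x, Summable fun n => r n • g n x) ∧
      ContDiff ℝ ∞ fun x => ∑' n, r n • g n x := by
  obtain ⟨δ, δpos, c, δc, -⟩ :
      ∃ δ : ℕ → NNReal, (∀ i : ℕ, 0 < δ i) ∧ ∃ c : NNReal, HasSum δ c ∧ c < 1 :=
    NNReal.exists_pos_sum_of_countable one_ne_zero ℕ
  have : ∀ n : ℕ, ∃ r : ℝ, 0 < r ∧ ∀ i ≤ n, ∀ x, ‖iteratedFDeriv ℝ i (r • g n) x‖ ≤ δ n := by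
    intro n
    have : ∀ i, ∃ R, ∀ x, ‖iteratedFDeriv ℝ i (g n) x‖ ≤ R := fun i =>
      ((hc n).iteratedFDeriv i).exists_bound_of_continuous
        ((hg n).continuous_iteratedFDeriv (mod_cast le_top))
    choose R hR using this
    -- `M` dominates all derivatives of `g n` of order at most `n`; the summand `1` makes it
    -- positive, so that `δ n / M` can serve as the scaling factor.
    let M := ∑ i ∈ Finset.range (n + 1), |R i| + 1
    have hM : 0 < M := by positivity
    have IR : ∀ i ≤ n, R i ≤ M := fun i hi => by
      have := Finset.single_le_sum (f := fun i => |R i|) (fun j _ => abs_nonneg _)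
        (Finset.mem_range.2 (Nat.lt_succ_of_le hi))
      have h2 := le_abs_self (R i)
      simp only [M]
      linarith
    have δnpos : 0 < δ n := δpos n
    refine ⟨M⁻¹ * δ n, by positivity, fun i hi x => ?_⟩
    rw [iteratedFDeriv_const_smul_apply ((hg n).contDiffAt.of_le (mod_cast le_top)), norm_smul,
      Real.norm_of_nonneg (by positivity)]
    calc M⁻¹ * δ n * ‖iteratedFDeriv ℝ i (g n) x‖ ≤ M⁻¹ * δ n * M := by
          gcongr
          exact (hR i x).trans (IR i hi)
      _ = δ n := by field_simp
  choose r rpos hr using this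
  refine ⟨r, rpos, fun x => ?_, ?_⟩
  · refine Summable.of_norm_bounded (NNReal.summable_coe.2 δc.summable) fun n => ?_
    simpa only [norm_iteratedFDeriv_zero] using! hr n 0 n.zero_le x
  · refine contDiff_tsum_of_eventually (fun k => (hg k).const_smul (r k))
      (fun k _ => (NNReal.hasSum_coe.2 δc).summable) ?_
    intro i _
    simp only [Nat.cofinite_eq_atTop, Filter.eventually_atTop]
    -- Order `i` is controlled only for the terms with `n ≥ i`; the finitely many others do not
    -- affect smoothness of the sum.
    exact ⟨i, fun n hn x => hr _ _ hn _⟩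

/-- An open set is covered by the supports of a sequence of smooth functions that are compactly
supported inside it. -/
theorem exists_seq_contDiff_tsupport_subset {E : Type*} [NormedAddCommGroup E] [NormedSpace ℝ E]
    [FiniteDimensional ℝ E] {U : Set E} (hU : IsOpen U) (hne : U.Nonempty) :
    ∃ g : ℕ → E → ℝ, (∀ n, tsupport (g n) ⊆ U) ∧ (∀ n, HasCompactSupport (g n)) ∧
      (∀ n, ContDiff ℝ ∞ (g n)) ∧ (∀ n x, 0 ≤ g n x) ∧ ∀ x ∈ U, ∃ n, g n x ≠ 0 := by
  have key : ∀ x ∈ U, ∃ f : E → ℝ, tsupport f ⊆ U ∧ HasCompactSupport f ∧ ContDiff ℝ ∞ f ∧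
      Set.range f ⊆ Set.Icc 0 1 ∧ f x = 1 := fun x hx =>
    exists_contDiff_tsupport_subset (hU.mem_nhds hx)
  choose! f hfU hfc hf hf01 hfx using key
  -- Lindelöf: countably many of the open supports already cover `U`.
  obtain ⟨T, hTU, hTc, hT⟩ := TopologicalSpace.countable_cover_nhdsWithin
    (s := U) (f := fun x => Function.support (f x)) fun x hx =>
      mem_nhdsWithin_of_mem_nhds ((hf x hx).continuous.isOpen_support.mem_nhds (by simp [hfx x hx]))
  have hTne : T.Nonempty := by
    obtain ⟨x, hx⟩ := hne
    obtain ⟨t, ht, -⟩ := Set.mem_iUnion₂.1 (hT hx)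
    exact ⟨t, ht⟩
  obtain ⟨p, rfl⟩ := hTc.exists_eq_range hTne
  have hp : ∀ n, p n ∈ U := fun n => hTU ⟨n, rfl⟩
  refine ⟨fun n => f (p n), fun n => hfU _ (hp n), fun n => hfc _ (hp n), fun n => hf _ (hp n),
    fun n x => (hf01 _ (hp n) ⟨x, rfl⟩).1, fun x hx => ?_⟩
  obtain ⟨_, ⟨n, rfl⟩, h⟩ := Set.mem_iUnion₂.1 (hT hx)
  exact ⟨n, h⟩

/-- A smooth function on an open set `U` becomes globally smooth after multiplication by a suitable
smooth function that has no zeros in `U`. -/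
theorem exists_contDiff_mul_extension {E : Type*} [NormedAddCommGroup E] [NormedSpace ℝ E]
    [FiniteDimensional ℝ E] {U : Set E} (hU : IsOpen U) (f : E → ℝ)
    (hf : ∀ x ∈ U, ContDiffAt ℝ ∞ f x) :
    ∃ s g : E → ℝ, ContDiff ℝ ∞ s ∧ ContDiff ℝ ∞ g ∧ (∀ x ∈ U, s x ≠ 0) ∧
      ∀ x, g x = s x * f x := by
  rcases U.eq_empty_or_nonempty with rfl | hne
  · exact ⟨0, 0, contDiff_const, contDiff_const, by simp, by simp⟩
  obtain ⟨φ, hφU, hφc, hφ, hφ0, hφU'⟩ := exists_seq_contDiff_tsupport_subset hU hne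
  have hφf : ∀ n, ContDiff ℝ ∞ fun x => φ n x * f x := fun n =>
    contDiff_iff_contDiffAt.2 fun x => by
      by_cases hx : x ∈ tsupport (φ n)
      · exact (hφ n).contDiffAt.mul (hf x (hφU n hx))
      · refine (contDiffAt_const (c := (0 : ℝ))).congr_of_eventuallyEq ?_
        filter_upwards [notMem_tsupport_iff_eventuallyEq.1 hx] with y hy
        simp [hy]
  -- Summing the pairs makes the same weights work for both components: `s = ∑ r n * φ n` and `g = ∑
  -- r n * φ n * f`.
  obtain ⟨r, hr, hsum, hsm⟩ := exists_pos_smul_contDiff_tsum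
    (fun n x => (φ n x, φ n x * f x)) (fun n => (hφ n).prodMk (hφf n))
    (fun n => (hφc n).mono fun x hx hx' => hx (by simp [hx']))
  have h1 : ∀ x, HasSum (fun n => r n * φ n x) (∑' n, r n • (φ n x, φ n x * f x)).1 := fun x =>
    (hsum x).hasSum.map (AddMonoidHom.fst ℝ ℝ) continuous_fst
  have h2 : ∀ x, HasSum (fun n => r n * (φ n x * f x)) (∑' n, r n • (φ n x, φ n x * f x)).2 :=
    fun x => (hsum x).hasSum.map (AddMonoidHom.snd ℝ ℝ) continuous_snd
  refine ⟨_, _, hsm.fst, hsm.snd, fun x hx => ?_, fun x => ?_⟩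
  · obtain ⟨n, hn⟩ := hφU' x hx
    rw [← (h1 x).tsum_eq]
    exact ((h1 x).summable.tsum_pos (fun i => mul_nonneg (hr i).le (hφ0 i x)) n
      (mul_pos (hr n) (lt_of_le_of_ne (hφ0 n x) hn.symm))).ne'
  · have := (h1 x).mul_right (f x)
    simp only [mul_assoc] at this
    exact (h2 x).unique this

/-! ### Smooth functions vanishing on `u i * u j = 1` -/

/-- A smooth function on the line that vanishes near `0` and equals `1` near `1`. -/
noncomputable def cutoff (t : ℝ) : ℝ := Real.smoothTransition (4 * t - 1)

theorem contDiff_cutoff : ContDiff ℝ ∞ cutoff := by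
  unfold cutoff
  exact Real.smoothTransition.contDiff.comp (by fun_prop)

theorem cutoff_eq_zero {t : ℝ} (ht : t < 1 / 4) : cutoff t = 0 :=
  Real.smoothTransition.zero_of_nonpos (by linarith)

theorem cutoff_eq_one {t : ℝ} (ht : 1 / 2 < t) : cutoff t = 1 :=
  Real.smoothTransition.one_of_one_le (by linarith)

/-- Where `u i = 0` the product `u i * u j` is below `1 / 4`, so the cutoff vanishes on a
neighbourhood and hides any singularity of `F`. -/
theorem contDiff_cutoff_mul {n : ℕ} (i j : Fin n) (F : (Fin n → ℝ) → ℝ)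
    (hF : ∀ u : Fin n → ℝ, u i ≠ 0 → ContDiffAt ℝ ∞ F u) :
    ContDiff ℝ ∞ fun u => cutoff (u i * u j) * F u := by
  refine contDiff_iff_contDiffAt.2 fun u => ?_
  by_cases h : u i * u j < 1 / 4
  · refine (contDiffAt_const (c := (0 : ℝ))).congr_of_eventuallyEq ?_
    have : ∀ᶠ v : Fin n → ℝ in nhds u, v i * v j < 1 / 4 :=
      (isOpen_lt (by fun_prop) continuous_const).mem_nhds h
    filter_upwards [this] with v hv
    rw [cutoff_eq_zero hv, zero_mul]
  · refine ContDiffAt.mul (contDiff_cutoff.comp (by fun_prop)).contDiffAt (hF u ?_)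
    rintro h0
    rw [h0] at h
    norm_num at h

/-- The numerator vanishes on a whole neighbourhood of the zero set of the denominator. -/
theorem contDiff_one_sub_cutoff_div {n : ℕ} (i j : Fin n) (F : (Fin n → ℝ) → ℝ)
    (hF : ContDiff ℝ ∞ F) :
    ContDiff ℝ ∞ fun u => (1 - cutoff (u i * u j)) / (u i * u j - 1) * F u := by
  refine ContDiff.mul (contDiff_iff_contDiffAt.2 fun u => ?_) hF
  by_cases h : u i * u j = 1
  · refine (contDiffAt_const (c := (0 : ℝ))).congr_of_eventuallyEq ?_
    have : ∀ᶠ v : Fin n → ℝ in nhds u, 1 / 2 < v i * v j :=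
      (isOpen_lt continuous_const (by fun_prop)).mem_nhds (by rw [Set.mem_ofPred_eq, h]; norm_num)
    filter_upwards [this] with v hv
    rw [cutoff_eq_one hv, sub_self, zero_div]
  · exact ContDiffAt.div
      (contDiff_const.sub (contDiff_cutoff.comp (by fun_prop))).contDiffAt
      (by fun_prop) (sub_ne_zero.2 h)

theorem contDiffAt_update_inv {n : ℕ} (i j : Fin n) {u : Fin n → ℝ} (h : u i ≠ 0) :
    ContDiffAt ℝ ∞ (fun v : Fin n → ℝ => Function.update v j (v i)⁻¹) u := by
  refine contDiffAt_pi.2 fun k => ?_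
  by_cases hk : k = j
  · subst hk
    simp only [Function.update_self]
    exact ContDiffAt.inv (by fun_prop) h
  · simp only [Function.update_of_ne hk]
    fun_prop

/-- A smooth function that vanishes on `{u | u i * u j = 1}` is a multiple of `u i * u j - 1`. -/
theorem exists_eq_mul_of_eq_zero {n : ℕ} {i j : Fin n} (hij : i ≠ j) (H : SmoothFun n)
    (hH : ∀ u : Fin n → ℝ, u i * u j = 1 → H.1 u = 0) :
    ∃ K : SmoothFun n, ∀ u, H.1 u = (u i * u j - 1) * K.1 u := by
  obtain ⟨g, hg, hHg⟩ := hadamard H.1 H.2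
  -- `P` retracts `u i ≠ 0` onto the hypersurface by changing coordinate `j` only, so Hadamard's
  -- formula between `u` and `P u` has a single term, with factor `u j - (u i)⁻¹ = (u i * u j - 1) /
  -- u i`.
  let P : (Fin n → ℝ) → Fin n → ℝ := fun u => Function.update u j (u i)⁻¹
  have hP : ∀ u : Fin n → ℝ, u i ≠ 0 → H.1 u = (u i * u j - 1) * ((u i)⁻¹ * g j (u, P u)) := by
    intro u hu
    have h0 : H.1 (P u) = 0 := hH _ (by simp [P, Function.update_of_ne hij, hu])
    have := hHg u (P u)
    rw [h0, sub_zero, Finset.sum_eq_single j (fun k _ hk => by simp [P, Function.update_of_ne hk])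
      (by simp)] at this
    rw [this]
    simp only [P, Function.update_self]
    field_simp
  -- Two local quotients are glued: Hadamard's near the hypersurface, and `H / (u i * u j - 1)` away
  -- from it.
  refine ⟨⟨fun u => cutoff (u i * u j) * ((u i)⁻¹ * g j (u, P u)) +
    (1 - cutoff (u i * u j)) / (u i * u j - 1) * H.1 u,
    (contDiff_cutoff_mul i j _ fun u hu => ?_).add (contDiff_one_sub_cutoff_div i j _ H.2)⟩,
    fun u => ?_⟩
  · refine ContDiffAt.mul (ContDiffAt.inv (by fun_prop) hu) ?_
    exact (hg j).contDiffAt.comp u (contDiffAt_id.prodMk (contDiffAt_update_inv i j hu))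
  · by_cases h1 : u i * u j = 1
    · simp [h1, hH u h1]
    · have h1' : u i * u j - 1 ≠ 0 := sub_ne_zero.2 h1
      simp only
      rw [mul_add, mul_left_comm, ← mul_assoc _ (_ / _), mul_div_cancel₀ _ h1']
      by_cases h0 : u i = 0
      · rw [h0, zero_mul, cutoff_eq_zero (by norm_num)]
        ring
      · rw [← hP u h0]
        ring

end SmoothFun

/-! ### Operations at points with `v i * v j = 1` -/

namespace CInftyRing

open SmoothFun

section

variable {B : Type*} [CommRing B] [Algebra ℝ B] [CInftyRing B]

theorem op_mul_apply {n : ℕ} (f g : SmoothFun n) (v : Fin n → B) :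
    op (⟨fun u => f.1 u * g.1 u, f.2.mul g.2⟩ : SmoothFun n) v = op f v * op g v := by
  have := op_comp SmoothFun.mul ![f, g] v
  rw [op_mul] at this
  exact this

theorem op_add_apply {n : ℕ} (f g : SmoothFun n) (v : Fin n → B) :
    op (⟨fun u => f.1 u + g.1 u, f.2.add g.2⟩ : SmoothFun n) v = op f v + op g v := by
  have := op_comp SmoothFun.add ![f, g] v
  rw [op_add] at this
  exact this

/-- Smooth functions that agree on `{u | u i * u j = 1}` agree on all points of a `C^∞`-ring that
satisfy this equation. -/
theorem op_eq_of_eqOn {n : ℕ} {i j : Fin n} (hij : i ≠ j) (f g : SmoothFun n)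
    (h : ∀ u : Fin n → ℝ, u i * u j = 1 → f.1 u = g.1 u) {v : Fin n → B} (hv : v i * v j = 1) :
    op f v = op g v := by
  obtain ⟨K, hK⟩ := exists_eq_mul_of_eq_zero hij ⟨fun u => f.1 u - g.1 u, f.2.sub g.2⟩
    fun u hu => sub_eq_zero.2 (h u hu)
  let e : SmoothFun n := ⟨fun u => u i * u j + -1, by fun_prop⟩
  have he : op e v = 0 := by
    have h1 := op_add_apply ⟨fun u => u i * u j, by fun_prop⟩ (SmoothFun.const n (-1)) v
    have h2 := op_mul_apply (SmoothFun.proj i) (SmoothFun.proj j) v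
    rw [op_proj, op_proj, hv] at h2
    refine h1.trans ?_
    rw [op_const, map_neg, map_one]
    exact (congrArg (· + -1) h2).trans (by ring)
  have hf : f = ⟨fun u => g.1 u + e.1 u * K.1 u, g.2.add (e.2.mul K.2)⟩ := by
    ext u
    have := hK u
    simp only [e] at this ⊢
    linarith
  have h1 := op_add_apply g ⟨fun u => e.1 u * K.1 u, e.2.mul K.2⟩ v
  rw [op_mul_apply, he, zero_mul, add_zero] at h1
  rw [hf]
  exact h1

end

/-! ### Elements of `A{a⁻¹}` as fractions -/

section Fractions

variable {A : Type*} [CommRing A] [Algebra ℝ A] [CInftyRing A]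
  {B : Type*} [CommRing B] [Algebra ℝ B] [CInftyRing B]

theorem isUnit_op {n : ℕ} {i j : Fin n} (hij : i ≠ j) (s : SmoothFun n)
    (hs : ∀ u : Fin n → ℝ, u i ≠ 0 → s.1 u ≠ 0) {v : Fin n → B} (hv : v i * v j = 1) :
    IsUnit (op s v) := by
  -- The cutoff makes `1 / s` globally smooth without changing it on the hypersurface.
  let t : SmoothFun n := ⟨fun u => cutoff (u i * u j) * (s.1 u)⁻¹,
    contDiff_cutoff_mul i j _ fun u hu => s.2.contDiffAt.inv (hs u hu)⟩
  refine IsUnit.of_mul_eq_one (op t v) ?_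
  rw [← op_mul_apply, op_eq_of_eqOn hij _ (SmoothFun.const n 1) (fun u hu => ?_) hv, op_const,
    map_one]
  have hi : u i ≠ 0 := left_ne_zero_of_mul_eq_one hu
  simp only [t, SmoothFun.const]
  rw [hu, cutoff_eq_one (by norm_num), one_mul, mul_inv_cancel₀ (hs u hi)]

theorem op_comp_update {n : ℕ} (f : SmoothFun n) (j : Fin n) (v : Fin n → B) :
    op (f.comp fun k => if k = j then SmoothFun.const n 0 else SmoothFun.proj k) v =
      op f (Function.update v j 0) := by
  rw [op_comp]
  congr 1
  funext k
  by_cases hk : k = j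
  · subst hk
    rw [if_pos rfl, op_const, map_zero, Function.update_self]
  · rw [if_neg hk, op_proj, Function.update_of_ne hk]

theorem comp_update_apply {n : ℕ} (f : SmoothFun n) (j : Fin n) (u : Fin n → ℝ) :
    (f.comp fun k => if k = j then SmoothFun.const n 0 else SmoothFun.proj k).1 u =
      f.1 (Function.update u j 0) := by
  simp only [SmoothFun.comp]
  refine congrArg f.1 (funext fun k => ?_)
  by_cases hk : k = j
  · subst hk
    simp [SmoothFun.const]
  · simp [hk, SmoothFun.proj]

/-- The value of an operation on elements of the image of `φ` and an inverse of such an element is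
a fraction of elements of the image. -/
theorem op_mul_eq_of_mul_eq_one {φ : A →ₐ[ℝ] B} (hφ : IsHom φ) {n : ℕ} {i j : Fin n} (hij : i ≠ j)
    (f : SmoothFun n) (x : Fin n → A) {v : Fin n → B} (hv : v i * v j = 1)
    (hx : ∀ k, k ≠ j → v k = φ (x k)) :
    ∃ s t : A, IsUnit (φ s) ∧ φ s * op f v = φ t := by
  obtain ⟨s, g, hs, hg, hs0, hgs⟩ := exists_contDiff_mul_extension
    (U := {u : Fin n → ℝ | u i ≠ 0}) (isOpen_ne_fun (by fun_prop) continuous_const)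
    (fun u => f.1 (Function.update u j (u i)⁻¹))
    (fun u hu => f.2.contDiffAt.comp u (contDiffAt_update_inv i j hu))
  -- `s` and `g` may depend on coordinate `j`, whose value need not lie in the image of `φ`. Setting
  -- it to `0` keeps `g = s * f`, as the extended function ignores that coordinate, and keeps `u i ≠
  -- 0` since `i ≠ j`.
  have hvx : Function.update v j 0 = fun k => φ (Function.update x j 0 k) := by
    funext k
    by_cases hk : k = j
    · subst hk
      simp
    · simp [Function.update_of_ne hk, hx k hk]
  have key : ∀ q : SmoothFun n,
      op (q.comp fun k => if k = j then SmoothFun.const n 0 else SmoothFun.proj k) v =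
        φ (op q (Function.update x j 0)) := fun q => by
    rw [op_comp_update, hvx, hφ.map_op q]
  refine ⟨op ⟨s, hs⟩ (Function.update x j 0), op ⟨g, hg⟩ (Function.update x j 0), ?_, ?_⟩
  · rw [← key]
    refine isUnit_op hij _ (fun u hu => ?_) hv
    rw [comp_update_apply]
    exact hs0 _ (by simpa [Function.update_of_ne hij] using hu)
  · rw [← key, ← key, ← op_mul_apply]
    refine op_eq_of_eqOn hij _ _ (fun u hu => ?_) hv
    simp only [comp_update_apply]
    rw [hgs, Function.update_of_ne hij, Function.update_idem, ← eq_inv_of_mul_eq_one_right hu,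
      Function.update_eq_self]

/-- Every element of `A{a⁻¹}` is a fraction of elements of the image of `A`. -/
theorem exists_toInvert_mul_eq (a : A) (b : Invert a) :
    ∃ s t : A, IsUnit (toInvert a s) ∧ toInvert a s * b = toInvert a t := by
  obtain ⟨F, rfl⟩ : ∃ F, Invert.mk a F = b := Ideal.Quotient.mk_surjective b
  obtain ⟨m, σ, g, rfl⟩ := free_eq_op F
  -- Two slots are prepended, for `a` and its inverse; `α` sends every generator `none` to slot `1`.
  -- The default `0` of `getD` is never read through `α`, and the entry `0` of `x` in slot `1` is a
  -- dummy.
  let x : Fin (m + 2) → A := Fin.cons a (Fin.cons 0 fun k => (σ k).getD 0)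
  let v : Fin (m + 2) → Invert a := Fin.cons (toInvert a a)
    (Fin.cons (Invert.mk a (X none)) fun k => toInvert a ((σ k).getD 0))
  let α : Fin m → Fin (m + 2) := fun k => if (σ k).isSome then k.succ.succ else 1
  have hv : (fun k => v (α k)) = fun k => Invert.mk a (X (σ k)) := by
    funext k
    rcases hk : σ k with _ | b
    · simp only [α, hk]
      rfl
    · simp only [α, hk]
      change toInvert a ((σ k).getD 0) = _
      rw [hk]
      rfl
  rw [(Invert.isHom_mk a).map_op g, ← hv, ← op_reindex]
  refine op_mul_eq_of_mul_eq_one (isHom_toInvert a) (i := 0) (j := 1) (by simp) _ x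
    (Invert.mk_mul a) fun k => ?_
  refine Fin.cases (fun _ => rfl) (fun k => ?_) k
  refine Fin.cases (fun h => (h rfl).elim) (fun k _ => rfl) k

/-- Elements of the extension of an ideal to `A{a⁻¹}` are fractions with numerator in the ideal. -/
theorem exists_toInvert_mul_eq_of_mem_map (a : A) (J : Ideal A) {b : Invert a}
    (hb : b ∈ J.map (toInvert a)) :
    ∃ s, ∃ t ∈ J, IsUnit (toInvert a s) ∧ toInvert a s * b = toInvert a t := by
  induction hb using Submodule.span_induction with
  | mem _ h =>
    obtain ⟨t, ht, rfl⟩ := h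
    exact ⟨1, t, ht, by simp, by simp⟩
  | zero => exact ⟨1, 0, J.zero_mem, by simp, by simp⟩
  | add b c _ _ hb hc =>
    obtain ⟨s, t, ht, hs, h⟩ := hb
    obtain ⟨s', t', ht', hs', h'⟩ := hc
    refine ⟨s * s', s' * t + s * t', J.add_mem (J.mul_mem_left _ ht) (J.mul_mem_left _ ht'),
      by rw [map_mul]; exact hs.mul hs', ?_⟩
    simp only [map_add, map_mul, ← h, ← h']
    ring
  | smul c b _ hb =>
    obtain ⟨s, t, ht, hs, h⟩ := hb
    -- The coefficient lies in `A{a⁻¹}`, hence is itself a fraction.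
    obtain ⟨s', t', hs', h'⟩ := exists_toInvert_mul_eq a c
    refine ⟨s * s', t' * t, J.mul_mem_left _ ht, by rw [map_mul]; exact hs.mul hs', ?_⟩
    simp only [smul_eq_mul, map_mul, ← h, ← h']
    ring

end Fractions

/-! ### Comparison and idempotence of the radicals -/

section Radicals

theorem realJacobson_mono {A : Type*} [CommRing A] [Algebra ℝ A] {I J : Ideal A} (h : I ≤ J) :
    realJacobson I ≤ realJacobson J :=
  sInf_le_sInf fun _ hM => ⟨h.trans hM.1, hM.2⟩

variable {A : Type u} [CommRing A] [Algebra ℝ A] [CInftyRing A]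

theorem mem_inftyRadical_iff {I : Ideal A} {a : A} :
    a ∈ inftyRadical I ↔
      ∀ (B : Type u) [CommRing B] [Algebra ℝ B] [CInftyRing B] (φ : A →ₐ[ℝ] B),
        IsHom φ → (∀ b ∈ I, φ b = 0) → IsUnit (φ a) → Subsingleton B :=
  subsingleton_invert_iff I a

theorem inftyRadical_mono {I J : Ideal A} (h : I ≤ J) : inftyRadical I ≤ inftyRadical J := by
  intro a ha
  rw [mem_inftyRadical_iff] at ha ⊢
  exact fun B _ _ _ φ hφ hJ => ha B φ hφ fun b hb => hJ b (h hb)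

theorem radical_le_inftyRadical (I : Ideal A) : I.radical ≤ inftyRadical I := by
  rintro a ⟨n, hn⟩
  rw [mem_inftyRadical_iff]
  intro B _ _ _ φ _ hI ha
  have h := ha.pow n
  rw [← map_pow, hI _ hn, isUnit_zero_iff] at h
  exact subsingleton_of_zero_eq_one h

theorem le_inftyRadical (I : Ideal A) : I ≤ inftyRadical I :=
  Ideal.le_radical.trans (radical_le_inftyRadical I)

/-- Localise first and divide by the extension of `inftyRadical I` afterwards: the result is
trivial, so `1` is a fraction whose numerator comes from `inftyRadical I` and is a unit. -/
theorem inftyRadical_idem (I : Ideal A) : inftyRadical (inftyRadical I) = inftyRadical I := by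
  refine le_antisymm (fun a ha => ?_) (le_inftyRadical _)
  rw [mem_inftyRadical_iff] at ha
  change Subsingleton (Invert (Ideal.Quotient.mk I a))
  let π : A →ₐ[ℝ] A ⧸ I := Ideal.Quotient.mkₐ ℝ I
  let τ : A ⧸ I →ₐ[ℝ] Invert (Ideal.Quotient.mk I a) := toInvert _
  let J : Ideal (A ⧸ I) := (inftyRadical I).map π
  have hτπ : IsHom (τ.comp π) := (isHom_toInvert _).comp (isHom_mk I)
  have h1 : Subsingleton (Invert (Ideal.Quotient.mk I a) ⧸ J.map τ) := by
    refine ha _ ((Ideal.Quotient.mkₐ ℝ (J.map τ)).comp (τ.comp π)) ((isHom_mk _).comp hτπ)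
      (fun b hb => ?_) ?_
    · exact Ideal.Quotient.eq_zero_iff_mem.2
        (Ideal.mem_map_of_mem τ (Ideal.mem_map_of_mem π hb))
    · exact (isUnit_toInvert (Ideal.Quotient.mk I a)).map (Ideal.Quotient.mkₐ ℝ (J.map τ))
  have h2 : (1 : Invert (Ideal.Quotient.mk I a)) ∈ J.map τ := by
    rw [Ideal.Quotient.subsingleton_iff.1 h1]
    trivial
  obtain ⟨s, t, ht, hs, hst⟩ := exists_toInvert_mul_eq_of_mem_map _ J h2
  obtain ⟨r, hr, rfl⟩ := (Ideal.mem_map_iff_of_surjective π Ideal.Quotient.mk_surjective).1 ht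
  rw [mul_one] at hst
  rw [hst] at hs
  -- `r` lies in `inftyRadical I` and becomes a unit under a morphism that kills `I`, so the target
  -- is trivial.
  exact mem_inftyRadical_iff.1 hr _ (τ.comp π) hτπ
    (fun b hb => by
      have : π b = 0 := Ideal.Quotient.eq_zero_iff_mem.2 hb
      rw [AlgHom.comp_apply, this, map_zero]) hs

/-- An element outside `M` becomes a unit in the field `A ⧸ M`, which is a nonzero `C^∞`-ring in
which `I` vanishes. -/
theorem inftyRadical_le_of_isMaximal {I M : Ideal A} (hM : M.IsMaximal) (h : I ≤ M) :
    inftyRadical I ≤ M := by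
  intro a ha
  by_contra haM
  let _ := Ideal.Quotient.field M
  refine not_subsingleton (A ⧸ M) (mem_inftyRadical_iff.1 ha (A ⧸ M) (Ideal.Quotient.mkₐ ℝ M)
    (isHom_mk M) (fun b hb => Ideal.Quotient.eq_zero_iff_mem.2 (h hb)) ?_)
  exact isUnit_iff_ne_zero.2 fun h0 => haM (Ideal.Quotient.eq_zero_iff_mem.1 h0)

theorem inftyRadical_le_realJacobson (I : Ideal A) : inftyRadical I ≤ realJacobson I :=
  le_sInf fun _ hM => inftyRadical_le_of_isMaximal hM.2.1 hM.1

/-- The maximal ideals over `I` with residue field `ℝ` all contain their intersection, so they are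
also counted for it. -/
theorem realJacobson_idem (I : Ideal A) : realJacobson (realJacobson I) = realJacobson I :=
  le_antisymm (le_sInf fun _ hM => sInf_le ⟨sInf_le hM, hM.2⟩)
    ((le_inftyRadical _).trans (inftyRadical_le_realJacobson _))

end Radicals

end CInftyRing

/-- Composing the nilradical, the `∞`-radical and the `ℝ`-Jacobson radical of ideals of
`C^∞`-rings gives nothing new. -/
theorem mainTheorem10 {A : Type*} [CommRing A] [Algebra ℝ A] [CInftyRing A] (I : Ideal A) :
    (I.radical.radical = I.radical ∧
      CInftyRing.inftyRadical (CInftyRing.inftyRadical I) = CInftyRing.inftyRadical I ∧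
      CInftyRing.realJacobson (CInftyRing.realJacobson I) = CInftyRing.realJacobson I) ∧
    (CInftyRing.inftyRadical I.radical = CInftyRing.inftyRadical I ∧
      CInftyRing.realJacobson (CInftyRing.inftyRadical I) = CInftyRing.realJacobson I ∧
      CInftyRing.realJacobson I.radical = CInftyRing.realJacobson I) ∧
    ((CInftyRing.inftyRadical I).radical = CInftyRing.inftyRadical I ∧
      (CInftyRing.realJacobson I).radical = CInftyRing.realJacobson I ∧
      CInftyRing.inftyRadical (CInftyRing.realJacobson I) = CInftyRing.realJacobson I) := by
  open CInftyRing in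
  have hn := radical_le_inftyRadical I
  have hr := inftyRadical_le_realJacobson I
  have hrr := realJacobson_idem I
  -- Squeezed between `realJacobson I` and its own `ℝ`-Jacobson radical.
  have hri : inftyRadical (realJacobson I) = realJacobson I :=
    le_antisymm ((inftyRadical_le_realJacobson _).trans hrr.le) (le_inftyRadical _)
  exact ⟨⟨Ideal.radical_idem I, inftyRadical_idem I, hrr⟩,
    ⟨le_antisymm ((inftyRadical_mono hn).trans (inftyRadical_idem I).le)
      (inftyRadical_mono Ideal.le_radical),
    le_antisymm ((realJacobson_mono hr).trans hrr.le) (realJacobson_mono (le_inftyRadical I)),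
    le_antisymm ((realJacobson_mono (hn.trans hr)).trans hrr.le)
      (realJacobson_mono Ideal.le_radical)⟩,
    ⟨le_antisymm ((radical_le_inftyRadical _).trans (inftyRadical_idem I).le) Ideal.le_radical,
    le_antisymm ((radical_le_inftyRadical _).trans hri.le) Ideal.le_radical, hri⟩⟩
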